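/- Let $k\ge 2$, and let ${\bf x}=a(0)a(1)a(2)\cdots$ be a $k$-automatic sequence over a linearly ordered alphabet: there is a finite deterministic automaton with output that, on reading the base-$k$ expansion of $n$ (most significant digit first, no leading zeros), outputs $a(n)$. Write ${\bf x}[i..\infty]$ for the infinite word $a(i)a(i+1)a(i+2)\cdots$. For $n\ge 0$ and $i\ge 0$, the permutation of length $n$ induced by ${\bf x}$ at position $i$ is the order on $\{0,\dots,n-1\}$ in which $l$ precedes $m$ if and only if ${\bf x}[i+l..\infty]$ is lexicographically less than ${\bf x}[i+m..\infty]$. (If ${\bf x}$ is not eventually periodic, this is a linear order, i.e. a permutation of $\{0,\dots,n-1\}$; if ${\bf x}$ is eventually periodic, equal suffixes are left incomparable.) The permutation complexity $p_{\bf x}(n)$ is the number of distinct orders induced in this way as $i$ ranges over all positions. **Theorem.** The sequence $(p_{\bf x}(n))_{n\ge 0}$ is $(\mathbb N,k)$-regular. That is, there are an integer $r\ge 0$, a row vector $u\in\mathbb N^{1\times r}$, a column vector $v\in\mathbb N^{r\times 1}$ and matrices $\mu(0),\dots,\mu(k-1)\in\mathbb N^{r\times r}$ such that $$p_{\bf x}\Bigl(\sum_{1\le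 j\le s} c_j k^{s-j}\Bigr)=u\,\mu(c_1)\mu(c_2)\cdots\mu(c_s)\,v$$ for every word $c_1c_2\cdots c_s$ $(s\ge 0)$ over the digits $\{0,1,\dots,k-1\}$. In particular, the permutation complexity of the Thue–Morse word, whose $n$-th letter is the parity of the number of ones in the binary expansion of $n$ (with $0<1$), is $(\mathbb N,2)$-regular. -/

import Mathlib

/-- The integer `[w]_k` represented in base `k` by the word `w`, most significant digit first. -/
def wordVal (k : ℕ) (w : List (Fin k)) : ℕ :=
  Nat.ofDigits k (w.reverse.map Fin.val)

/-- Canonical base-`k` expansions: the empty word and the words whose first letter is not `0`. -/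
def IsCanonical {k : ℕ} (w : List (Fin k)) : Prop :=
  ∀ a ∈ w.head?, (a : ℕ) ≠ 0

/-- `x` is `k`-automatic: some finite automaton with output, reading the canonical base-`k`
expansion of `n` (most significant digit first), outputs `x n`. -/
def IsAutomatic (k : ℕ) {A : Type*} (x : ℕ → A) : Prop :=
  ∃ (Q : Type) (_ : Finite Q) (M : DFA (Fin k) Q) (out : Q → A),
    ∀ w : List (Fin k), IsCanonical w → x (wordVal k w) = out (M.eval w)

/-- A formal series `h : Σ* → R` is `R`-recognizable if it has a linear representation
`(u, μ, v)`, i.e. `h w = u * μ(w) * v`, where `μ` is the morphism from words to square matrices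
determined by its values on letters. -/
def IsRecognizable (R : Type*) [Semiring R] {S : Type*} (h : List S → R) : Prop :=
  ∃ (r : ℕ) (u : Fin r → R) (μ : S → Matrix (Fin r) (Fin r) R) (v : Fin r → R),
    ∀ w : List S, h w = u ⬝ᵥ ((w.map μ).prod.mulVec v)

/-- `f` is `(R, k)`-regular: `w ↦ f([w]_k)` is an `R`-recognizable series on all words over
the digits `0, …, k - 1` (leading zeros included). -/
def IsRegularSeq (R : Type*) [Semiring R] (k : ℕ) (f : ℕ → R) : Prop :=
  IsRecognizable R (fun w : List (Fin k) => f (wordVal k w))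

/-- The infinite word `x[i..∞]`, as an element of the lexicographically ordered sequences. -/
def suffix {A : Type*} (x : ℕ → A) (i : ℕ) : Lex (ℕ → A) :=
  toLex (fun t => x (i + t))

/-- The order on `{0, …, n - 1}` induced by the lexicographic order of the `n` suffixes of `x`
starting at the positions `i, …, i + n - 1`. -/
def inducedOrder {A : Type*} [LinearOrder A] (x : ℕ → A) (n i : ℕ) : Fin n → Fin n → Prop :=
  fun l m => suffix x (i + l) < suffix x (i + m)

/-- Permutation complexity: the number of distinct orders on `{0, …, n - 1}` induced by `x`.
See `permComplexity_eq_ncard_perm` for the form with permutations. -/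
noncomputable def permComplexity {A : Type*} [LinearOrder A] (x : ℕ → A) (n : ℕ) : ℕ :=
  (Set.range (inducedOrder x n)).ncard

/-- The Thue–Morse word: the parity of the number of ones in the binary expansion of `n`. -/
def thueMorse (n : ℕ) : ℕ := (Nat.digits 2 n).sum % 2

/-- If the suffixes of `x` are pairwise distinct (equivalently, `x` is not eventually periodic),
the induced orders are linear, and `permComplexity x n` is the number of permutations `σ` of
`{0, …, n - 1}` that are order isomorphic to `n` consecutive suffixes of `x`. -/
theorem permComplexity_eq_ncard_perm {A : Type*} [LinearOrder A] (x : ℕ → A)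
    (hx : Function.Injective (suffix x)) (n : ℕ) :
    permComplexity x n =
      {σ : Equiv.Perm (Fin n) | ∃ i, ∀ l m : Fin n,
        σ l < σ m ↔ suffix x (i + l) < suffix x (i + m)}.ncard := by
  classical
  symm
  refine Set.ncard_congr (fun σ _ => fun l m : Fin n => σ l < σ m) ?_ ?_ ?_
  · rintro σ ⟨i, hi⟩
    exact ⟨i, by funext l m; exact propext (hi l m).symm⟩
  · intro σ τ _ _ h
    have h' : ∀ l m, σ l < σ m ↔ τ l < τ m := fun l m => iff_of_eq (congrFun (congrFun h l) m)
    have hm : StrictMono (σ.symm.trans τ) := by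
      intro a b hab
      have := (h' (σ.symm a) (σ.symm b)).1 (by simpa using hab)
      simpa using this
    have he : (hm.orderIsoOfSurjective _ (σ.symm.trans τ).surjective) = OrderIso.refl (Fin n) :=
      Subsingleton.elim _ _
    ext l : 1
    have := congrArg (fun e : Fin n ≃o Fin n => e (σ l)) he
    simpa using this.symm
  · rintro _ ⟨i, rfl⟩
    let f : Fin n → Lex (ℕ → A) := fun l => suffix x (i + l)
    have hf : Function.Injective f := fun l m h => by
      have := hx h
      exact Fin.ext (by omega)
    let s : Finset (Lex (ℕ → A)) := Finset.univ.image f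
    have hs : s.card = n := by
      rw [Finset.card_image_of_injective _ hf, Finset.card_univ, Fintype.card_fin]
    let g : Fin n → Fin n := fun l => (s.orderIsoOfFin hs).symm ⟨f l, by simp [s]⟩
    have hg : ∀ l m, g l < g m ↔ f l < f m := fun l m => by
      simp only [g, OrderIso.lt_iff_lt, Subtype.mk_lt_mk]
      exact Iff.rfl
    have hgi : Function.Injective g := fun l m h => by
      apply hf
      have h1 := (hg l m).not.1 (by simp [h])
      have h2 := (hg m l).not.1 (by simp [h])
      exact le_antisymm (not_lt.1 h2) (not_lt.1 h1)
    refine ⟨Equiv.ofBijective g (Finite.injective_iff_bijective.1 hgi), ⟨i, fun l m => ?_⟩, ?_⟩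
    · exact hg l m
    · funext l m
      exact propext (hg l m)

/-!
`permComplexity x n` counts the positions `i` at which the order induced on `{0, …, n - 1}` occurs
for the first time. This relation between `n` and `i` is first-order definable from `x`, `+` and
`<`, and relations that are automatic in several variables are closed under Boolean operations,
quantification over `ℕ` and substitution of sums, so it is automatic.

If an automatic relation `P` holds, for each `n`, for finitely many `i` only, then
`n ↦ #{i | P n i}` is regular. Only finitely many counting series arise when both numbers are read
digit by digit, and removing the first digit of `n` turns such a series into a sum of series of the
same kind, one for each first digit of `i`. As `i` may have more digits than `n`, the total count is
a sum over the leading parts of `i`; only finitely many of them contribute, because each of the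
finitely many nonzero series can arise from finitely many leading parts only. So the count lies in
a finitely generated module of series that is stable under removal of the first letter, and every
series in such a module has a linear representation.
-/

section Automatic

variable {k : ℕ} {ι κ A B C : Type*}

theorem wordVal_append (w u : List (Fin k)) :
    wordVal k (w ++ u) = k ^ u.length * wordVal k w + wordVal k u := by
  simp [wordVal, Nat.ofDigits_append, add_comm]

theorem wordVal_singleton (c : Fin k) : wordVal k [c] = c := by
  simp [wordVal]

theorem wordVal_lt (w : List (Fin k)) : wordVal k w < k ^ w.length := by
  induction w using List.reverseRecOn with
  | nil => simp [wordVal]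
  | append_singleton w c ih =>
    rw [wordVal_append, wordVal_singleton, List.length_append, List.length_singleton, pow_one,
      pow_succ']
    calc k * wordVal k w + c < k * (wordVal k w + 1) := by rw [mul_add_one]; gcongr; exact c.2
      _ ≤ k * k ^ w.length := by gcongr; exact ih

theorem exists_length_eq_wordVal_eq {s c : ℕ} (hc : c < k ^ s) :
    ∃ w : List (Fin k), w.length = s ∧ wordVal k w = c := by
  induction s generalizing c with
  | zero => exact ⟨[], rfl, by simp_all [wordVal]⟩
  | succ s ih =>
    have hk : 0 < k := Nat.pos_of_ne_zero fun h => by simp [h] at hc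
    obtain ⟨w, hlen, hw⟩ := ih (Nat.div_lt_of_lt_mul (by rwa [← pow_succ']) : c / k < k ^ s)
    refine ⟨w ++ [⟨c % k, Nat.mod_lt c hk⟩], by simp [hlen], ?_⟩
    simp [wordVal_append, wordVal_singleton, hw, Nat.div_add_mod]

theorem IsCanonical.append {w : List (Fin k)} (hw : IsCanonical w) (hne : w ≠ [])
    (u : List (Fin k)) : IsCanonical (w ++ u) := by
  rwa [IsCanonical, List.head?_append_of_ne_nil _ hne]

theorem exists_isCanonical_wordVal_eq (hk : 1 < k) (n : ℕ) :
    ∃ w : List (Fin k), IsCanonical w ∧ wordVal k w = n := by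
  induction n using Nat.strongRecOn with
  | ind n ih =>
    rcases Nat.eq_zero_or_pos n with rfl | hn
    · exact ⟨[], by simp [IsCanonical], by simp [wordVal]⟩
    obtain ⟨w, hcanon, hw⟩ := ih (n / k) (Nat.div_lt_self hn hk)
    let c : Fin k := ⟨n % k, Nat.mod_lt n (by omega)⟩
    have hval : wordVal k (w ++ [c]) = n := by
      simp [wordVal_append, wordVal_singleton, hw, c, Nat.div_add_mod]
    refine ⟨w ++ [c], ?_, hval⟩
    by_cases hne : w = []
    · subst hne
      rw [List.nil_append, wordVal_singleton] at hval
      simpa [IsCanonical, hval] using hn.ne'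
    · exact hcanon.append hne [c]

/-- All values of `f : ℕ^ι → A` at the arguments obtained from `v` by appending `s` further base-`k`
digits to every coordinate; the appended blocks are encoded by their values `c i < k ^ s`. -/
def digitResidual (k : ℕ) (f : (ι → ℕ) → A) (v : ι → ℕ) :
    (s : ℕ) → (ι → Fin (k ^ s)) → A :=
  fun s c => f fun i => k ^ s * v i + c i

/-- Multidimensional `k`-automatic sequences `f : ℕ^ι → A` (automatic relations when `A = Prop`):
`f` has finitely many residuals. By the Myhill–Nerode theorem this says that `f` is computed by a
finite automaton reading the base-`k` expansions of all coordinates in parallel, most significant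
digit first. -/
def IsMultiAutomatic (k : ℕ) (f : (ι → ℕ) → A) : Prop :=
  (Set.range (digitResidual k f)).Finite

namespace IsMultiAutomatic

theorem of_digitResidual_eq_comp {Q : Type*} {f : (ι → ℕ) → A} {state : (ι → ℕ) → Q}
    (hstate : (Set.range state).Finite) (F : Q → (s : ℕ) → (ι → Fin (k ^ s)) → A)
    (h : ∀ v s c, digitResidual k f v s c = F (state v) s c) : IsMultiAutomatic k f := by
  have hcomp : digitResidual k f = F ∘ state := by
    funext v s c
    exact h v s c
  rw [IsMultiAutomatic, hcomp, Set.range_comp]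
  exact hstate.image F

theorem map {f : (ι → ℕ) → A} (hf : IsMultiAutomatic k f) (g : A → B) :
    IsMultiAutomatic k fun v => g (f v) :=
  of_digitResidual_eq_comp hf (fun R s c => g (R s c)) fun _ _ _ => rfl

theorem map₂ {f : (ι → ℕ) → A} {g : (ι → ℕ) → B} (hf : IsMultiAutomatic k f) (op : A → B → C)
    (hg : IsMultiAutomatic k g) : IsMultiAutomatic k fun v => op (f v) (g v) := by
  have hpair : (Set.range fun v => (digitResidual k f v, digitResidual k g v)).Finite :=
    (Set.Finite.prod hf hg).subset (Set.range_subset_iff.2 fun v => ⟨⟨v, rfl⟩, v, rfl⟩)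
  exact of_digitResidual_eq_comp hpair (fun R s c => op (R.1 s c) (R.2 s c)) fun _ _ _ => rfl

theorem lt (a b : ι) : IsMultiAutomatic k fun v : ι → ℕ => v a < v b := by
  refine of_digitResidual_eq_comp (state := fun v : ι → ℕ => (v a < v b, v a = v b))
    (Set.toFinite _) (fun p _ c => p.1 ∨ p.2 ∧ c a < c b) fun v s c => propext ?_
  have ha := (c a).2
  have hb := (c b).2
  change k ^ s * v a + c a < k ^ s * v b + c b ↔ v a < v b ∨ v a = v b ∧ c a < c b
  rcases lt_trichotomy (v a) (v b) with h | h | h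
  · simp only [h, true_or, iff_true]
    nlinarith
  · simp [h]
  · simp only [h.not_gt, h.ne', false_and, or_self, iff_false, not_lt]
    nlinarith

section Quantifiers

variable [NeZero k] {P : (ι → ℕ) → ℕ → Prop}

/-- As in the subset construction, the state attached to `v` is the set of the residuals attached to
`(v, j)` for all `j`. -/
theorem exists_nat (hP : IsMultiAutomatic k fun v : Option ι → ℕ => P (v ∘ some) (v none)) :
    IsMultiAutomatic k fun v => ∃ j, P v j := by
  let f (v : Option ι → ℕ) : Prop := P (v ∘ some) (v none)
  let state (v : ι → ℕ) := Set.range fun j => digitResidual k f fun o => o.elim j v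
  have hstate : (Set.range state).Finite :=
    hP.finite_subsets.subset <| Set.range_subset_iff.2 fun v => Set.range_subset_iff.2 fun j =>
      Set.mem_range_self _
  refine of_digitResidual_eq_comp hstate
    (fun S s c => ∃ R ∈ S, ∃ d : Fin (k ^ s), R s fun o => o.elim d c) fun v s c => propext ?_
  simp only [state, Set.exists_range_iff]
  constructor
  · rintro ⟨j, hj⟩
    refine ⟨j / k ^ s, Fin.ofNat (k ^ s) j, ?_⟩
    simpa [digitResidual, f, Function.comp_def, Nat.div_add_mod] using hj
  · rintro ⟨j, d, h⟩
    exact ⟨k ^ s * j + d, h⟩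

theorem forall_nat (hP : IsMultiAutomatic k fun v : Option ι → ℕ => P (v ∘ some) (v none)) :
    IsMultiAutomatic k fun v => ∀ j, P v j := by
  simpa only [not_exists, not_not] using ((hP.map Not).exists_nat (P := fun v j => ¬ P v j)).map Not

end Quantifiers

/-- Since `c, d < k ^ s` give `c + d < 2 * k ^ s`, the carry into a leading part is `0` or `1`, so
the residuals of `f` at `v ∘ a + v ∘ b + ε` with `ε ∈ {0, 1}^ι` determine the new residual. -/
theorem comp_add [NeZero k] [Finite ι] {f : (ι → ℕ) → A} (hf : IsMultiAutomatic k f)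
    (a b : ι → κ) : IsMultiAutomatic k fun v : κ → ℕ => f fun i => v (a i) + v (b i) := by
  let state (v : κ → ℕ) (ε : ι → Fin 2) := digitResidual k f fun i => v (a i) + v (b i) + ε i
  have hstate : (Set.range state).Finite :=
    (Set.Finite.pi' fun _ => hf).subset
      (Set.range_subset_iff.2 fun v ε => Set.mem_range_self _)
  refine of_digitResidual_eq_comp hstate
    (fun R s c => R (fun i => Fin.ofNat 2 ((c (a i) + c (b i) : ℕ) / k ^ s)) s
      fun i => Fin.ofNat (k ^ s) (c (a i) + c (b i))) fun v s c => ?_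
  refine congrArg f (funext fun i => ?_)
  have hcarry : (c (a i) + c (b i) : ℕ) / k ^ s < 2 :=
    Nat.div_lt_of_lt_mul (by have := (c (a i)).2; have := (c (b i)).2; omega)
  simp only [Fin.val_ofNat, Nat.mod_eq_of_lt hcarry]
  conv_lhs => rw [add_add_add_comm, ← Nat.div_add_mod (c (a i) + c (b i) : ℕ) (k ^ s)]
  ring

end IsMultiAutomatic

theorem IsAutomatic.isMultiAutomatic {x : ℕ → A} (hk : 1 < k) (hx : IsAutomatic k x) (a : ι) :
    IsMultiAutomatic k fun v : ι → ℕ => x (v a) := by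
  obtain ⟨Q, _, M, out, hM⟩ := hx
  choose canon hcanon hval using exists_isCanonical_wordVal_eq hk
  choose block hlen hblock using @exists_length_eq_wordVal_eq k
  -- Digits appended to `0` give a word with leading zeros, hence the extra state `none`.
  let state (v : ι → ℕ) : Option Q := if v a = 0 then none else some (M.eval (canon (v a)))
  refine .of_digitResidual_eq_comp (state := state) (Set.toFinite _) (fun q s c =>
    q.elim (x (c a)) fun q => out (M.evalFrom q (block (c a).2))) fun v s c => ?_
  by_cases hv : v a = 0
  · simp [digitResidual, state, hv]
  have hne : canon (v a) ≠ [] := fun h => hv (by rw [← hval (v a), h]; simp [wordVal])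
  have happend : wordVal k (canon (v a) ++ block (c a).2) = k ^ s * v a + c a := by
    rw [wordVal_append, hlen, hval, hblock]
  simp only [digitResidual, state, hv, if_false, Option.elim_some]
  rw [← happend, hM _ ((hcanon _).append hne _), DFA.eval, DFA.evalFrom_of_append]

theorem IsAutomatic.isMultiAutomatic_add {x : ℕ → A} (hk : 1 < k) (hx : IsAutomatic k x)
    (a b : ι) : IsMultiAutomatic k fun v : ι → ℕ => x (v a + v b) := by
  have : NeZero k := ⟨by omega⟩
  exact (hx.isMultiAutomatic hk ()).comp_add (fun _ => a) fun _ => b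

section InducedOrder

variable [LinearOrder A] {x : ℕ → A}

theorem IsAutomatic.isMultiAutomatic_suffix_lt (hk : 1 < k) (hx : IsAutomatic k x) (a b : ι) :
    IsMultiAutomatic k fun v : ι → ℕ => suffix x (v a) < suffix x (v b) := by
  have : NeZero k := ⟨by omega⟩
  change IsMultiAutomatic k fun v : ι → ℕ =>
    ∃ t, (∀ s, s < t → x (v a + s) = x (v b + s)) ∧ x (v a + t) < x (v b + t)
  have letter {κ : Type _} (i j : κ) := hx.isMultiAutomatic_add hk i j
  exact .exists_nat <| .map₂
    (.forall_nat <| .map₂ (.lt _ _) (· → ·) <| .map₂ (letter _ _) (· = ·) (letter _ _))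
    (· ∧ ·) <| .map₂ (letter _ _) (· < ·) (letter _ _)

theorem inducedOrder_eq_iff (n i j : ℕ) :
    inducedOrder x n i = inducedOrder x n j ↔ ∀ l, l < n → ∀ m, m < n →
      (suffix x (i + l) < suffix x (i + m) ↔ suffix x (j + l) < suffix x (j + m)) := by
  simp only [funext_iff, inducedOrder, eq_iff_iff, Fin.forall_iff]

theorem IsAutomatic.isMultiAutomatic_inducedOrder_eq (hk : 1 < k) (hx : IsAutomatic k x)
    (n i j : ι) : IsMultiAutomatic k fun v : ι → ℕ =>
      inducedOrder x (v n) (v i) = inducedOrder x (v n) (v j) := by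
  have : NeZero k := ⟨by omega⟩
  have suffix_lt (a b c d : Option (Option ι)) :
      IsMultiAutomatic k fun v => suffix x (v a + v b) < suffix x (v c + v d) :=
    (hx.isMultiAutomatic_suffix_lt hk (0 : Fin 2) 1).comp_add ![a, c] ![b, d]
  simp only [inducedOrder_eq_iff]
  exact .forall_nat <| .map₂ (.lt _ _) (· → ·) <| .forall_nat <| .map₂ (.lt _ _) (· → ·) <|
    .map₂ (suffix_lt _ _ _ _) (· ↔ ·) (suffix_lt _ _ _ _)

end InducedOrder

/-- One half of Jacob's characterization of the recognizable series. -/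
theorem isRecognizable_of_mem_span {R S : Type*} [Semiring R] {G : Set (List S → R)}
    (hG : G.Finite)
    (hstable : ∀ g ∈ G, ∀ c, (fun w => g (c :: w)) ∈ Submodule.span R G)
    {h : List S → R} (hh : h ∈ Submodule.span R G) : IsRecognizable R h := by
  obtain ⟨r, g, _, rfl⟩ := hG.fin_param
  simp only [Submodule.mem_span_range_iff_exists_fun, Set.forall_mem_range] at hstable hh
  choose μ hμ using hstable
  obtain ⟨u, rfl⟩ := hh
  have mulVec_eq (w : List S) :
      (w.map fun c => Matrix.of fun q => μ q c).prod.mulVec (fun q => g q []) =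
        fun q => g q w := by
    induction w with
    | nil => simp
    | cons c w ih =>
      rw [List.map_cons, List.prod_cons, ← Matrix.mulVec_mulVec, ih]
      funext q
      simpa [Matrix.mulVec, dotProduct] using congrFun (hμ q c) w
  refine ⟨r, u, fun c => Matrix.of fun q => μ q c, fun q => g q [], fun w => ?_⟩
  simp [mulVec_eq, dotProduct]

theorem ncard_fin_mul (a b : ℕ) (p : ℕ → Prop) :
    {j : Fin (a * b) | p j}.ncard = ∑ d : Fin a, {j : Fin b | p (b * d + j)}.ncard := by
  classical
  simp only [Set.ncard_eq_toFinset_card', Set.toFinset_ofPred, Finset.card_filter]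
  rw [← Fintype.sum_prod_type' (f := fun d j => if p (b * (d : Fin a) + (j : Fin b)) then 1 else 0)]
  exact (Fintype.sum_equiv finProdFinEquiv _ _ fun dj => by simp [add_comm]).symm

/-- The counting series of `P` with leading parts `n` and `i`: the number of ways to continue `i` by
a block of `|w|` digits, encoded by its value `j`, such that `P` holds when `n` is continued by the
digits `w`. -/
noncomputable def blockCount (k : ℕ) (P : ℕ → ℕ → Prop) (n i : ℕ) (w : List (Fin k)) : ℕ :=
  {j : Fin (k ^ w.length) | P (k ^ w.length * n + wordVal k w) (k ^ w.length * i + j)}.ncard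

section BlockCount

variable {P : ℕ → ℕ → Prop}

theorem blockCount_cons (n i : ℕ) (c : Fin k) (w : List (Fin k)) :
    blockCount k P n i (c :: w) = ∑ d : Fin k, blockCount k P (k * n + c) (k * i + d) w := by
  have hn : k ^ (w.length + 1) * n + wordVal k (c :: w) =
      k ^ w.length * (k * n + c) + wordVal k w := by
    rw [← List.singleton_append, wordVal_append, wordVal_singleton]
    ring
  have hi (d j : ℕ) : k ^ (w.length + 1) * i + (k ^ w.length * d + j) =
      k ^ w.length * (k * i + d) + j := by ring
  simp only [blockCount, List.length_cons, hn, ← hi]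
  rw [pow_succ']
  exact ncard_fin_mul k (k ^ w.length) fun j =>
    P (k ^ w.length * (k * n + c) + wordVal k w) (k * k ^ w.length * i + j)

theorem IsMultiAutomatic.finite_range_blockCount
    (hP : IsMultiAutomatic k fun v : Fin 2 → ℕ => P (v 0) (v 1)) :
    (Set.range fun ni : ℕ × ℕ => blockCount k P ni.1 ni.2).Finite := by
  let count (R : (s : ℕ) → (Fin 2 → Fin (k ^ s)) → Prop) (w : List (Fin k)) : ℕ :=
    {j | R w.length ![⟨wordVal k w, wordVal_lt w⟩, j]}.ncard
  exact (hP.image count).subset <| Set.range_subset_iff.2 fun ni =>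
    ⟨_, ⟨![ni.1, ni.2], rfl⟩, rfl⟩

theorem finite_setOf_blockCount_zero_ne [NeZero k] (hfin : ∀ n, {i | P n i}.Finite)
    (w : List (Fin k)) : {m | blockCount k P 0 m w ≠ 0}.Finite := by
  refine ((hfin (wordVal k w)).image (· / k ^ w.length)).subset fun m hm => ?_
  obtain ⟨j, hj⟩ := Set.nonempty_of_ncard_ne_zero hm
  refine ⟨k ^ w.length * m + j, by simpa using hj, ?_⟩
  simp [Nat.mul_add_div (pow_pos (NeZero.pos k) w.length)]

/-- Only finitely many functions `blockCount k P 0 m` occur, and each nonzero one occurs for only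
finitely many `m`. -/
theorem IsMultiAutomatic.exists_blockCount_zero_eq_zero [NeZero k]
    (hP : IsMultiAutomatic k fun v : Fin 2 → ℕ => P (v 0) (v 1))
    (hfin : ∀ n, {i | P n i}.Finite) : ∃ N, ∀ m, N ≤ m → blockCount k P 0 m = 0 := by
  have hsupport : {m | blockCount k P 0 m ≠ 0}.Finite := by
    refine .of_finite_fibers (blockCount k P 0) (hP.finite_range_blockCount.subset ?_) ?_
    · rintro _ ⟨m, _, rfl⟩
      exact ⟨(0, m), rfl⟩
    · rintro _ ⟨m, hm, rfl⟩
      obtain ⟨w, hw⟩ := Function.ne_iff.1 hm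
      refine (finite_setOf_blockCount_zero_ne hfin w).subset fun m' hm' => ?_
      rwa [Set.mem_ofPred_eq, show blockCount k P 0 m' = blockCount k P 0 m from hm'.2]
  obtain ⟨N, hN⟩ := hsupport.bddAbove
  exact ⟨N + 1, fun m hm => by_contra fun h => absurd (hN h) (by omega)⟩

theorem ncard_eq_sum_blockCount [NeZero k] {N : ℕ} (hN : ∀ m, N ≤ m → blockCount k P 0 m = 0)
    (w : List (Fin k)) :
    {i | P (wordVal k w) i}.ncard = ∑ m : Fin N, blockCount k P 0 m w := by
  have hK : 0 < k ^ w.length := pow_pos (NeZero.pos k) _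
  have hbound (i) (hi : P (wordVal k w) i) : i < N * k ^ w.length := by
    by_contra! hNi
    have hzero : blockCount k P 0 (i / k ^ w.length) w = 0 :=
      congrFun (hN _ ((Nat.le_div_iff_mul_le hK).2 hNi)) w
    refine ((Set.ncard_pos (Set.toFinite _)).2 ?_).ne' hzero
    exact ⟨⟨i % k ^ w.length, Nat.mod_lt i hK⟩, by simpa [Nat.div_add_mod] using hi⟩
  have himage : {i | P (wordVal k w) i} =
      Fin.val '' {i : Fin (N * k ^ w.length) | P (wordVal k w) i} := by
    ext i
    exact ⟨fun hi => ⟨⟨i, hbound i hi⟩, hi, rfl⟩, by rintro ⟨i, hi, rfl⟩; exact hi⟩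
  rw [himage, Set.ncard_image_of_injective _ Fin.val_injective,
    ncard_fin_mul N (k ^ w.length) fun i => P (wordVal k w) i]
  simp only [blockCount, mul_zero, zero_add]

theorem IsMultiAutomatic.isRegularSeq_ncard [NeZero k]
    (hP : IsMultiAutomatic k fun v : Fin 2 → ℕ => P (v 0) (v 1))
    (hfin : ∀ n, {i | P n i}.Finite) : IsRegularSeq ℕ k fun n => {i | P n i}.ncard := by
  obtain ⟨N, hN⟩ := hP.exists_blockCount_zero_eq_zero hfin
  have mem_span (n i : ℕ) : blockCount k P n i ∈
      Submodule.span ℕ (Set.range fun ni : ℕ × ℕ => blockCount k P ni.1 ni.2) :=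
    Submodule.subset_span ⟨(n, i), rfl⟩
  refine isRecognizable_of_mem_span hP.finite_range_blockCount ?_ ?_
  · rintro _ ⟨⟨n, i⟩, rfl⟩ c
    have hquotient : (fun w => blockCount k P n i (c :: w)) =
        ∑ d : Fin k, blockCount k P (k * n + c) (k * i + d) := by
      funext w
      rw [blockCount_cons, Finset.sum_apply]
    exact hquotient ▸ Submodule.sum_mem _ fun d _ => mem_span _ _
  · have hsum : (fun w => {i | P (wordVal k w) i}.ncard) =
        ∑ m : Fin N, blockCount k P 0 m := by
      funext w
      rw [ncard_eq_sum_blockCount hN, Finset.sum_apply]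
    exact hsum ▸ Submodule.sum_mem _ fun m _ => mem_span _ _

end BlockCount

theorem bijOn_firstOccurrences [LinearOrder ι] [WellFoundedLT ι] (f : ι → B) :
    Set.BijOn f {i | ∀ j < i, f i ≠ f j} (Set.range f) := by
  refine ⟨fun i _ => ⟨i, rfl⟩, fun i hi j hj hij => ?_, ?_⟩
  · rcases lt_trichotomy i j with h | h | h
    · exact absurd hij.symm (hj i h)
    · exact h
    · exact absurd hij (hi j h)
  · rintro _ ⟨i, rfl⟩
    obtain ⟨m, hm, hmin⟩ := WellFounded.has_min (wellFounded_lt (α := ι)) {j | f j = f i} ⟨i, rfl⟩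
    exact ⟨m, fun j hj h => hmin j (h.symm.trans hm) hj, hm⟩

theorem IsAutomatic.isRegularSeq_permComplexity [LinearOrder A] {x : ℕ → A} (hk : 1 < k)
    (hx : IsAutomatic k x) : IsRegularSeq ℕ k (permComplexity x) := by
  have : NeZero k := ⟨by omega⟩
  let IsFirst (n i : ℕ) : Prop := ∀ j < i, inducedOrder x n i ≠ inducedOrder x n j
  have hbij (n) : Set.BijOn (inducedOrder x n) {i | IsFirst n i} (Set.range (inducedOrder x n)) :=
    bijOn_firstOccurrences _
  have hFirst : IsMultiAutomatic k fun v : Fin 2 → ℕ => IsFirst (v 0) (v 1) :=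
    .forall_nat <| .map₂ (.lt _ _) (· → ·) <|
      (hx.isMultiAutomatic_inducedOrder_eq hk _ _ _).map Not
  have hcount : permComplexity x = fun n => {i | IsFirst n i}.ncard :=
    funext fun n => (hbij n).ncard_eq.symm
  rw [hcount]
  exact hFirst.isRegularSeq_ncard fun n => (hbij n).finite_iff_finite.2 (Set.toFinite _)

end Automatic

theorem thueMorse_two_mul_add (m : ℕ) (c : Fin 2) :
    thueMorse (2 * m + c) = (thueMorse m + c) % 2 := by
  by_cases h : (c : ℕ) = 0 ∧ m = 0
  · simp [h.1, h.2, thueMorse]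
  · rw [thueMorse, add_comm, Nat.digits_add 2 one_lt_two c m c.2 (by tauto), List.sum_cons,
      thueMorse, Nat.mod_add_mod, add_comm]

theorem isAutomatic_thueMorse : IsAutomatic 2 thueMorse := by
  let M : DFA (Fin 2) (Fin 2) := ⟨fun q c => q + c, 0, ∅⟩
  have eval_eq (w : List (Fin 2)) : thueMorse (wordVal 2 w) = M.eval w := by
    induction w using List.reverseRecOn with
    | nil => simp [wordVal, thueMorse, M]
    | append_singleton w c ih =>
      rw [wordVal_append, List.length_singleton, pow_one, wordVal_singleton,
        thueMorse_two_mul_add, DFA.eval_append_singleton, Fin.val_add, ih]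
  exact ⟨Fin 2, inferInstance, M, Fin.val, fun w _ => eval_eq w⟩

theorem mainTheorem11 :
    (∀ (k : ℕ) (_ : 2 ≤ k) (A : Type*) [LinearOrder A] (x : ℕ → A),
      IsAutomatic k x → IsRegularSeq ℕ k (permComplexity x)) ∧
    IsRegularSeq ℕ 2 (permComplexity thueMorse) :=
  ⟨fun _ hk _ _ _ hx => hx.isRegularSeq_permComplexity hk,
    isAutomatic_thueMorse.isRegularSeq_permComplexity one_lt_two⟩
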